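/- Let $n\ge 1$ and let $G$ be a connected undirected multigraph without self-loops on the vertices $v_0,\dots,v_n$. Let $b_{ij}$ be the number of edges between $v_i$ and $v_j$, and let $Q=D-A$ be the Laplacian matrix of $G$, that is, $Q_{ij}=-b_{ij}$ for $i\ne j$ and $Q_{ii}=\sum_{j\neq i} b_{ij}$. Let $L_G\subset\mathbb R^{n+1}$ be the Laplacian lattice, the group generated by the rows of $Q$; it is a sublattice of the root lattice $A_n=\{x\in\mathbb Z^{n+1} : \sum_{i=0}^{n} x_i=0\}$. Let $\triangle$ be the regular simplex that is the convex hull of the points $t_0,\dots,t_n\in\mathbb R^{n+1}$, where $t_i$ has $i$-th coordinate $n$ and all other coordinates $-1$; for $R\ge 0$ put $\triangle(p,R)=p+R\cdot\triangle$. For a sublattice $L$ of $A_n$ let $$\mathrm{Pac}_\triangle(L)=\sup\{R\ge 0 : \triangle(q_1,R)\cap\triangle(q_2,R)=\emptyset \text{ for all } q_1\ne q_2 \text{ in } L\},$$ $$\mathrm{Cov}_\triangle(L)=\inf\{R\ge 0 : \text{every } p\in \mathrm{Span}_{\mathbb R}(L) \text{ lies in } \triangle(q,R) \text{ for some } q\in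 L\}$$ be its packing and covering radius, let $\mathrm{Cvol}(L)=|A_n/L|$, and let $$\gamma_\triangle(L)=\frac{\mathrm{Pac}_\triangle(L)}{((n+1)\,\mathrm{Cvol}(L))^{1/n}},\qquad \theta_\triangle(L)=\frac{\mathrm{Cov}_\triangle(L)}{((n+1)\,\mathrm{Cvol}(L))^{1/n}}$$ be its packing and covering density. Let $\mathrm{MC}_1(G)$ be the minimum, over all subsets $S$ of the vertex set that are neither empty nor the whole vertex set, of the number of edges of $G$ (with multiplicity) between $S$ and its complement. Then $Q$ has exactly $n$ non-zero eigenvalues $\lambda_1\le\dots\le\lambda_n$, counted with multiplicity, and $$\gamma_\triangle(L_G)=\frac{\mathrm{MC}_1(G)}{(n+1)\left(\prod_{i=1}^n\lambda_i\right)^{1/n}},\qquad \theta_\triangle(L_G)=\frac{\sum_{i=1}^n\lambda_i}{2(n+1)\left(\prod_{i=1}^n\lambda_i\right)^{1/n}}.$$ -/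

import Mathlib

open scoped BigOperators

/-- A finite undirected multigraph without self-loops on the vertex set `V`, given by its edge
multiplicities: `mult v w` is the number of edges joining `v` and `w`. -/
structure LoopFreeMultigraph (V : Type*) where
  mult : V → V → ℕ
  mult_symm : ∀ v w, mult v w = mult w v
  mult_self : ∀ v, mult v v = 0

namespace LoopFreeMultigraph

/-- The simple graph that joins two vertices when at least one edge runs between them. -/
def underlying {V : Type*} (G : LoopFreeMultigraph V) : SimpleGraph V where
  Adj v w := 0 < G.mult v w
  symm := ⟨fun v w h => by rw [G.mult_symm w v]; exact h⟩
  loopless := ⟨fun v h => by simp [G.mult_self v] at h⟩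

/-- A multigraph is connected if any two vertices are joined by a path of edges. -/
def Connected {V : Type*} (G : LoopFreeMultigraph V) : Prop :=
  G.underlying.Connected

/-- The degree of a vertex, edges counted with multiplicity. -/
def degree {V : Type*} [Fintype V] (G : LoopFreeMultigraph V) (v : V) : ℕ :=
  ∑ w, G.mult v w

/-- The Laplacian matrix `D(G) - A(G)`, with real entries. -/
def laplacian {V : Type*} [Fintype V] [DecidableEq V] (G : LoopFreeMultigraph V) :
    Matrix V V ℝ :=
  Matrix.diagonal (fun v => (G.degree v : ℝ)) - Matrix.of (fun v w => (G.mult v w : ℝ))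

/-- The Laplacian lattice: the group generated by the rows of the Laplacian matrix. -/
def laplacianLattice {V : Type*} [Fintype V] [DecidableEq V] (G : LoopFreeMultigraph V) :
    AddSubgroup (V → ℝ) :=
  AddSubgroup.closure (Set.range (fun v : V => G.laplacian v))

/-- The degree of `v` across the cut `S`, for a vertex `v` of `S`: the number of edges from `v`
to the complement of `S`. -/
def cutDegree {V : Type*} [Fintype V] [DecidableEq V] (G : LoopFreeMultigraph V)
    (S : Finset V) (v : V) : ℕ :=
  ∑ w ∈ Sᶜ, G.mult v w

/-- The weight of the cut `S`. -/
def cutWeight {V : Type*} [Fintype V] [DecidableEq V] (G : LoopFreeMultigraph V)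
    (S : Finset V) : ℕ :=
  ∑ v ∈ S, G.cutDegree S v

/-- The minimum cut: the least weight of a non-trivial cut. -/
noncomputable def minCut {V : Type*} [Fintype V] [DecidableEq V] (G : LoopFreeMultigraph V) : ℕ :=
  sInf {c : ℕ | ∃ S : Finset V, S.Nonempty ∧ S ≠ Finset.univ ∧ c = G.cutWeight S}

/-- The non-zero eigenvalues of the Laplacian matrix, each with its multiplicity. -/
noncomputable def nonzeroEigenvalues {V : Type*} [Fintype V] [DecidableEq V]
    (G : LoopFreeMultigraph V) : Multiset ℝ :=
  G.laplacian.charpoly.roots.filter (fun x => x ≠ 0)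

end LoopFreeMultigraph

namespace SimplicialLattice

/-- The root lattice `A_n`: the integer points of the hyperplane of vectors in `ℝ^(n+1)` whose
coordinates sum to zero. -/
def rootLattice (n : ℕ) : AddSubgroup (Fin (n + 1) → ℝ) where
  carrier := {x | (∀ i, ∃ k : ℤ, x i = k) ∧ ∑ i, x i = 0}
  zero_mem' := ⟨fun _ => ⟨0, by simp⟩, by simp⟩
  add_mem' := by
    rintro x y ⟨hx, hx0⟩ ⟨hy, hy0⟩
    refine ⟨fun i => ?_, ?_⟩
    · obtain ⟨a, ha⟩ := hx i
      obtain ⟨b, hb⟩ := hy i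
      exact ⟨a + b, by simp [ha, hb]⟩
    · simp [Finset.sum_add_distrib, hx0, hy0]
  neg_mem' := by
    rintro x ⟨hx, hx0⟩
    refine ⟨fun i => ?_, ?_⟩
    · obtain ⟨a, ha⟩ := hx i
      exact ⟨-a, by simp [ha]⟩
    · simp [hx0]

/-- The covolume of a sublattice `L` of `A_n`: the cardinality of the quotient `A_n / L`. -/
noncomputable def covolume {n : ℕ} (L : AddSubgroup (Fin (n + 1) → ℝ)) : ℕ :=
  Nat.card (rootLattice n ⧸ L.addSubgroupOf (rootLattice n))

/-- The vertices `t_0, …, t_n` of the regular simplex. -/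
def simplexVertex (n : ℕ) (i : Fin (n + 1)) : Fin (n + 1) → ℝ :=
  fun j => if i = j then (n : ℝ) else -1

/-- The regular simplex `△`. -/
def simplex (n : ℕ) : Set (Fin (n + 1) → ℝ) :=
  convexHull ℝ (Set.range (simplexVertex n))

/-- `P(p, R) = p + R • P`: the dilation of `P` by the factor `R`, moved to the centre `p`. -/
def dilate {n : ℕ} (P : Set (Fin (n + 1) → ℝ)) (p : Fin (n + 1) → ℝ) (R : ℝ) :
    Set (Fin (n + 1) → ℝ) :=
  (fun x => p + R • x) '' P

/-- The packing radius of `L` with respect to `P`. -/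
noncomputable def packingRadius {n : ℕ} (P : Set (Fin (n + 1) → ℝ))
    (L : AddSubgroup (Fin (n + 1) → ℝ)) : ℝ :=
  sSup {R : ℝ | 0 ≤ R ∧ ∀ p ∈ L, ∀ q ∈ L, p ≠ q → dilate P p R ∩ dilate P q R = ∅}

/-- The covering radius of `L` with respect to `P`. -/
noncomputable def coveringRadius {n : ℕ} (P : Set (Fin (n + 1) → ℝ))
    (L : AddSubgroup (Fin (n + 1) → ℝ)) : ℝ :=
  sInf {R : ℝ | 0 ≤ R ∧
    ∀ p ∈ Submodule.span ℝ (L : Set (Fin (n + 1) → ℝ)), ∃ q ∈ L, p ∈ dilate P q R}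

/-- The packing density of a sublattice `L` of `A_n` with respect to `P`. -/
noncomputable def packingDensity {n : ℕ} (P : Set (Fin (n + 1) → ℝ))
    (L : AddSubgroup (Fin (n + 1) → ℝ)) : ℝ :=
  packingRadius P L / (((n : ℝ) + 1) * (covolume L : ℝ)) ^ (1 / (n : ℝ))

/-- The covering density of a sublattice `L` of `A_n` with respect to `P`. -/
noncomputable def coveringDensity {n : ℕ} (P : Set (Fin (n + 1) → ℝ))
    (L : AddSubgroup (Fin (n + 1) → ℝ)) : ℝ :=
  coveringRadius P L / (((n : ℝ) + 1) * (covolume L : ℝ)) ^ (1 / (n : ℝ))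

end SimplicialLattice

/-! A point x lies in △(p,R) exactly when x and p have the same coordinate sum and x ≥ p - R
coordinatewise (`mem_dilate_simplex`); both radii thus become questions about coordinatewise order.

Packing: △(p,R) and △(q,R) meet iff the positive part of p - q has sum at most (n+1)R. For a nonzero
lattice vector Qc that sum is at least the weight of the cut around the set where c is maximal
(`minCut_le_sum_posPart`), and the indicator of a minimum cut attains it.

Covering: let m be the number of edges. A vector of total m dominates some Qc, found by minimising
the Dirichlet energy (`Connected.exists_laplacian_mulVec_le`), so m/(n+1) suffices. The indegrees of
an acyclic orientation, also of total m, never strictly dominate a lattice point in every coordinate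
(`exists_lowerDegree_le_laplacian_mulVec`), so nothing smaller suffices.

Normalisation: the trace gives Σλ = 2m, while the linear coefficient of the characteristic
polynomial gives ∏λ = (n+1) det of the reduced Laplacian. That determinant is also the covolume
(`covolume_laplacianLattice`). -/

open Matrix

namespace LoopFreeMultigraph

/-! ### Laplacian: quadratic form, kernel, image, lattice. -/

section Laplacian

variable {V : Type*} [Fintype V] [DecidableEq V] (G : LoopFreeMultigraph V)

theorem laplacian_mulVec_apply (c : V → ℝ) (v : V) :
    (G.laplacian *ᵥ c) v = ∑ w, (G.mult v w : ℝ) * (c v - c w) := by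
  rw [laplacian, Matrix.sub_mulVec, Pi.sub_apply, Matrix.mulVec_diagonal]
  simp [degree, mul_sub, Finset.sum_mul, Matrix.mulVec, dotProduct]

theorem laplacian_transpose : G.laplacianᵀ = G.laplacian := by
  ext v w
  by_cases h : v = w
  · subst h; simp
  · simp [laplacian, Matrix.diagonal_apply_ne _ h, Matrix.diagonal_apply_ne' _ h, G.mult_symm v w]

theorem laplacian_apply_comm (v w : V) : G.laplacian v w = G.laplacian w v :=
  congrFun (congrFun G.laplacian_transpose w) v

theorem laplacian_isHermitian : G.laplacian.IsHermitian := by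
  rw [Matrix.IsHermitian, Matrix.conjTranspose_eq_transpose_of_trivial, laplacian_transpose]

theorem laplacian_apply_self (v : V) : G.laplacian v v = (G.degree v : ℝ) := by
  simp [laplacian, G.mult_self]

theorem laplacian_trace : G.laplacian.trace = ∑ v, (G.degree v : ℝ) := by
  simp [Matrix.trace, laplacian_apply_self]

theorem sum_laplacian_mulVec (c : V → ℝ) : ∑ v, (G.laplacian *ᵥ c) v = 0 := by
  have h : ∑ v, (G.laplacian *ᵥ c) v = -∑ v, (G.laplacian *ᵥ c) v := by
    simp only [laplacian_mulVec_apply]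
    conv_lhs => rw [Finset.sum_comm]
    rw [← Finset.sum_neg_distrib]
    refine Finset.sum_congr rfl fun v _ => ?_
    rw [← Finset.sum_neg_distrib]
    refine Finset.sum_congr rfl fun w _ => ?_
    rw [G.mult_symm w v]; ring
  linarith

theorem laplacian_mulVec_one : G.laplacian *ᵥ (1 : V → ℝ) = 0 := by
  ext v; simp [laplacian_mulVec_apply]

/-- The energy of a potential: twice the sum over the edges of the squared difference. -/
def energy (c : V → ℝ) : ℝ := ∑ v, ∑ w, (G.mult v w : ℝ) * (c v - c w) ^ 2

omit [DecidableEq V] in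
theorem energy_nonneg (c : V → ℝ) : 0 ≤ G.energy c :=
  Finset.sum_nonneg fun _ _ => Finset.sum_nonneg fun _ _ => by positivity

theorem two_mul_dotProduct_laplacian (c : V → ℝ) :
    2 * (c ⬝ᵥ (G.laplacian *ᵥ c)) = G.energy c := by
  have h1 : c ⬝ᵥ (G.laplacian *ᵥ c) = ∑ v, ∑ w, (G.mult v w : ℝ) * (c v * (c v - c w)) := by
    simp only [dotProduct, laplacian_mulVec_apply, Finset.mul_sum]
    exact Finset.sum_congr rfl fun _ _ => Finset.sum_congr rfl fun _ _ => by ring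
  have h2 : c ⬝ᵥ (G.laplacian *ᵥ c) = ∑ v, ∑ w, (G.mult v w : ℝ) * (c w * (c w - c v)) := by
    rw [h1, Finset.sum_comm]
    exact Finset.sum_congr rfl fun v _ => Finset.sum_congr rfl fun w _ => by
      rw [G.mult_symm w v]
  rw [two_mul]
  nth_rewrite 1 [h1]
  rw [h2, energy, ← Finset.sum_add_distrib]
  refine Finset.sum_congr rfl fun v _ => ?_
  rw [← Finset.sum_add_distrib]
  exact Finset.sum_congr rfl fun w _ => by ring

theorem laplacian_posSemidef : G.laplacian.PosSemidef := by
  refine Matrix.PosSemidef.of_dotProduct_mulVec_nonneg G.laplacian_isHermitian fun c => ?_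
  have := G.two_mul_dotProduct_laplacian c
  have := G.energy_nonneg c
  simp only [star_trivial]
  linarith

omit [DecidableEq V] in
theorem mult_mul_sq_le_energy (c : V → ℝ) (v w : V) :
    (G.mult v w : ℝ) * (c v - c w) ^ 2 ≤ G.energy c :=
  (Finset.single_le_sum (f := fun w => (G.mult v w : ℝ) * (c v - c w) ^ 2)
    (fun _ _ => by positivity) (Finset.mem_univ w)).trans
  (Finset.single_le_sum (f := fun v => ∑ w, (G.mult v w : ℝ) * (c v - c w) ^ 2)
    (fun _ _ => Finset.sum_nonneg fun _ _ => by positivity) (Finset.mem_univ v))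

variable {G}

omit [Fintype V] [DecidableEq V] in
/-- A property that spreads along edges of a connected multigraph holds everywhere. -/
theorem Connected.induction (hG : G.Connected) {P : V → Prop} {v₀ : V} (h₀ : P v₀)
    (h : ∀ v w, 0 < G.mult v w → P v → P w) (v : V) : P v := by
  obtain ⟨p⟩ := hG.preconnected v₀ v
  induction p with
  | nil => exact h₀
  | cons hadj _ ih => exact ih (h _ _ hadj h₀)

theorem Connected.eq_of_laplacian_mulVec_eq_zero (hG : G.Connected) {c : V → ℝ}
    (hc : G.laplacian *ᵥ c = 0) (v w : V) : c v = c w := by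
  have he : G.energy c = 0 := by rw [← two_mul_dotProduct_laplacian, hc]; simp
  refine (hG.induction (P := fun w => c v = c w) rfl (fun a b hab ha => ?_) w)
  have h1 := G.mult_mul_sq_le_energy c a b
  rw [he] at h1
  have hab' : (0 : ℝ) < G.mult a b := by exact_mod_cast hab
  have h2 : (c a - c b) ^ 2 = 0 :=
    le_antisymm (by by_contra hh; push Not at hh; nlinarith) (sq_nonneg _)
  rw [ha]; nlinarith [pow_eq_zero_iff (two_ne_zero) |>.1 h2]

/-- The image of the Laplacian of a connected multigraph is the hyperplane of vectors of sum
zero. -/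
theorem Connected.exists_laplacian_mulVec_eq (hG : G.Connected) {p : V → ℝ}
    (hp : ∑ v, p v = 0) : ∃ x : V → ℝ, G.laplacian *ᵥ x = p := by
  obtain ⟨v₀⟩ := hG.nonempty
  -- Adding the all-ones matrix removes the kernel. Since J multiplies coordinate sums by |V|, a
  -- preimage of a sum-zero vector has sum zero, and there J agrees with Q.
  let J : (V → ℝ) →ₗ[ℝ] (V → ℝ) := G.laplacian.mulVecLin +
    (∑ v, LinearMap.proj v : (V → ℝ) →ₗ[ℝ] ℝ).smulRight (1 : V → ℝ)
  have hJ : ∀ x, J x = G.laplacian *ᵥ x + (∑ v, x v) • (1 : V → ℝ) := fun x => by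
    simp [J]
  have hcard : (0 : ℝ) < Fintype.card V := by
    exact_mod_cast Fintype.card_pos_iff.2 ⟨v₀⟩
  have hsum : ∀ x, ∑ v, J x v = Fintype.card V * ∑ v, x v := fun x => by
    rw [hJ]
    simp [Finset.sum_add_distrib, sum_laplacian_mulVec]
  have hzero : ∀ x, ∑ v, J x v = 0 → J x = G.laplacian *ᵥ x ∧ ∑ v, x v = 0 := fun x hx => by
    rw [hsum] at hx
    have : ∑ v, x v = 0 := by simpa [hcard.ne'] using hx
    exact ⟨by rw [hJ, this]; simp, this⟩
  have hinj : Function.Injective J := by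
    rw [injective_iff_map_eq_zero]
    intro x hx
    obtain ⟨h1, h2⟩ := hzero x (by simp [hx])
    rw [hx] at h1
    have hconst := hG.eq_of_laplacian_mulVec_eq_zero h1.symm
    ext v
    have : ∑ w, x w = Fintype.card V * x v := by
      rw [Finset.sum_congr rfl fun w _ => hconst w v]; simp
    rw [h2] at this
    simpa [hcard.ne'] using this.symm
  obtain ⟨x, hx⟩ := LinearMap.injective_iff_surjective.1 hinj p
  exact ⟨x, by rw [← (hzero x (by rw [hx, hp])).1, hx]⟩

variable (G)

theorem mem_laplacianLattice {x : V → ℝ} :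
    x ∈ G.laplacianLattice ↔ ∃ c : V → ℤ, x = G.laplacian *ᵥ (fun v => (c v : ℝ)) := by
  rw [laplacianLattice, ← Submodule.span_int_eq_addSubgroupClosure, Submodule.mem_toAddSubgroup,
    Submodule.mem_span_range_iff_exists_fun]
  refine exists_congr fun c => ?_
  rw [eq_comm]
  refine Eq.congr_right ?_
  ext w
  simp [Matrix.mulVec, dotProduct, mul_comm, G.laplacian_apply_comm w]

theorem laplacian_mulVec_intCast_mem (c : V → ℤ) :
    G.laplacian *ᵥ (fun v => (c v : ℝ)) ∈ G.laplacianLattice :=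
  G.mem_laplacianLattice.2 ⟨c, rfl⟩

variable {G}

theorem Connected.mem_span_laplacianLattice (hG : G.Connected) {p : V → ℝ} :
    p ∈ Submodule.span ℝ (G.laplacianLattice : Set (V → ℝ)) ↔ ∑ v, p v = 0 := by
  constructor
  · intro hp
    induction hp using Submodule.span_induction with
    | mem x hx =>
      obtain ⟨c, rfl⟩ := G.mem_laplacianLattice.1 hx
      exact G.sum_laplacian_mulVec _
    | zero => simp
    | add x y _ _ hx hy => simp [Finset.sum_add_distrib, hx, hy]
    | smul a x _ hx => simp [← Finset.mul_sum, hx]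
  · intro hp
    obtain ⟨x, rfl⟩ := hG.exists_laplacian_mulVec_eq hp
    have : G.laplacian *ᵥ x = ∑ v, x v • G.laplacian v := by
      ext w
      simp [Matrix.mulVec, dotProduct, mul_comm, G.laplacian_apply_comm w]
    rw [this]
    exact Submodule.sum_mem _ fun v _ => Submodule.smul_mem _ _
      (Submodule.subset_span (AddSubgroup.subset_closure ⟨v, rfl⟩))

end Laplacian

end LoopFreeMultigraph

namespace LoopFreeMultigraph

/-! ### Minimum cuts and positive parts of lattice vectors. -/

section Cuts

variable {V : Type*} [Fintype V] [DecidableEq V] {G : LoopFreeMultigraph V}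

/-- In (Qc)(v) = Σ mult · (c v - c w) no term is negative, and by integrality each edge leaving S
contributes at least 1. -/
theorem cutDegree_le_laplacian_mulVec {c : V → ℤ} {S : Finset V} {v : V}
    (hv : ∀ w, c w ≤ c v) (hS : ∀ w ∉ S, c w < c v) :
    (G.cutDegree S v : ℝ) ≤ (G.laplacian *ᵥ (fun v => (c v : ℝ))) v := by
  rw [laplacian_mulVec_apply, cutDegree, Nat.cast_sum]
  calc ∑ w ∈ Sᶜ, (G.mult v w : ℝ) ≤ ∑ w ∈ Sᶜ, (G.mult v w : ℝ) * ((c v : ℝ) - c w) := by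
        refine Finset.sum_le_sum fun w hw => ?_
        have h1 : (c w : ℝ) + 1 ≤ c v := by exact_mod_cast hS w (Finset.mem_compl.1 hw)
        exact le_mul_of_one_le_right (Nat.cast_nonneg _) (by linarith)
    _ ≤ ∑ w, (G.mult v w : ℝ) * ((c v : ℝ) - c w) := by
        refine Finset.sum_le_sum_of_subset_of_nonneg (Finset.subset_univ _) fun w _ _ => ?_
        have h1 : (c w : ℝ) ≤ c v := by exact_mod_cast hv w
        exact mul_nonneg (Nat.cast_nonneg _) (by linarith)

theorem minCut_le_sum_posPart [Nonempty V] {c : V → ℤ}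
    (hc : G.laplacian *ᵥ (fun v => (c v : ℝ)) ≠ 0) :
    (G.minCut : ℝ) ≤ ∑ v, max ((G.laplacian *ᵥ (fun v => (c v : ℝ))) v) 0 := by
  set q := G.laplacian *ᵥ (fun v => (c v : ℝ)) with hq
  obtain ⟨m, hm⟩ := Finite.exists_max c
  -- Every vertex of the argmax set receives at least its cut degree; the set is proper because a
  -- constant c would give Qc = 0.
  let S : Finset V := Finset.univ.filter fun v => c v = c m
  have hSne : S ≠ Finset.univ := fun h => hc <| by
    have hconst : ∀ v, c v = c m := fun v => by
      have : v ∈ S := h ▸ Finset.mem_univ v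
      simpa [S] using this
    rw [hq]
    ext v
    simp [laplacian_mulVec_apply, hconst]
  have hmin : G.minCut ≤ G.cutWeight S :=
    Nat.sInf_le ⟨S, ⟨m, by simp [S]⟩, hSne, rfl⟩
  calc (G.minCut : ℝ) ≤ G.cutWeight S := by exact_mod_cast hmin
    _ = ∑ v ∈ S, (G.cutDegree S v : ℝ) := by simp [cutWeight]
    _ ≤ ∑ v ∈ S, max (q v) 0 := by
        refine Finset.sum_le_sum fun v hv => le_max_of_le_left ?_
        have hv' : c v = c m := by simpa [S] using hv
        refine cutDegree_le_laplacian_mulVec (fun w => hv' ▸ hm w) fun w hw => ?_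
        exact lt_of_le_of_ne (hv' ▸ hm w) (by simpa [S, hv'] using hw)
    _ ≤ ∑ v, max (q v) 0 :=
        Finset.sum_le_sum_of_subset_of_nonneg (Finset.subset_univ _) fun _ _ _ => le_max_right _ _

theorem exists_cutWeight_eq_minCut [Nontrivial V] (G : LoopFreeMultigraph V) :
    ∃ S : Finset V, S.Nonempty ∧ S ≠ Finset.univ ∧ G.minCut = G.cutWeight S := by
  obtain ⟨v, w, hvw⟩ := exists_pair_ne V
  refine Nat.sInf_mem (s := {c : ℕ | ∃ S : Finset V, S.Nonempty ∧ S ≠ Finset.univ ∧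
    c = G.cutWeight S}) ⟨_, {v}, by simp, fun h => hvw ?_, rfl⟩
  have : w ∈ ({v} : Finset V) := h ▸ Finset.mem_univ w
  exact (Finset.mem_singleton.1 this).symm

theorem Connected.minCut_pos [Nontrivial V] (hG : G.Connected) : 0 < G.minCut := by
  obtain ⟨S, ⟨v₀, hv₀⟩, hne, hS⟩ := G.exists_cutWeight_eq_minCut
  rw [hS]
  by_contra h
  have h0 : ∀ v ∈ S, ∀ w ∉ S, G.mult v w = 0 := by
    have h1 : G.cutWeight S = 0 := by omega
    simpa [cutWeight, cutDegree] using h1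
  refine hne (Finset.eq_univ_iff_forall.2 (hG.induction hv₀ fun v w hvw hv => ?_))
  by_contra hw
  exact hvw.ne' (h0 v hv w hw)

theorem sum_posPart_laplacian_mulVec_indicator (S : Finset V) :
    ∑ v, max ((G.laplacian *ᵥ (fun v => (((if v ∈ S then 1 else 0 : ℤ)) : ℝ))) v) 0 =
      G.cutWeight S := by
  rw [cutWeight, Nat.cast_sum, ← Finset.sum_subset (Finset.subset_univ S)]
  · refine Finset.sum_congr rfl fun v hv => ?_
    rw [max_eq_left, laplacian_mulVec_apply, cutDegree, Nat.cast_sum,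
      ← Finset.sum_subset (Finset.subset_univ Sᶜ)]
    · refine Finset.sum_congr rfl fun w hw => ?_
      simp [hv, Finset.mem_compl.1 hw]
    · intro w _ hw
      simp [hv, not_not.1 (fun h => hw (Finset.mem_compl.2 h))]
    · rw [laplacian_mulVec_apply]
      refine Finset.sum_nonneg fun w _ => mul_nonneg (Nat.cast_nonneg _) ?_
      simp only [hv, if_true]
      split_ifs <;> simp
  · intro v _ hv
    refine max_eq_right ?_
    rw [laplacian_mulVec_apply]
    refine Finset.sum_nonpos fun w _ => mul_nonpos_of_nonneg_of_nonpos (Nat.cast_nonneg _) ?_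
    simp only [hv, if_false]
    split_ifs <;> simp

end Cuts

/-! ### Dominating lattice points: energy minimisers and acyclic orientations. -/

section Covering

variable {V : Type*} [Fintype V] [DecidableEq V] {G : LoopFreeMultigraph V}

/-- The indegree of a vertex when every edge is oriented towards its larger end. -/
def lowerDegree [LinearOrder V] (G : LoopFreeMultigraph V) (v : V) : ℕ :=
  ∑ w ∈ Finset.univ.filter (· < v), G.mult v w

theorem two_mul_sum_lowerDegree {V : Type*} [Fintype V] [LinearOrder V]
    (G : LoopFreeMultigraph V) : 2 * ∑ v, G.lowerDegree v = ∑ v, G.degree v := by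
  have h1 : ∑ v, G.lowerDegree v = ∑ v, ∑ w, if w < v then G.mult v w else 0 := by
    simp [lowerDegree, Finset.sum_filter]
  have h2 : ∑ v, G.lowerDegree v = ∑ v, ∑ w, if v < w then G.mult v w else 0 := by
    rw [h1, Finset.sum_comm]
    exact Finset.sum_congr rfl fun v _ => Finset.sum_congr rfl fun w _ => by
      rw [G.mult_symm w v]
  rw [two_mul]
  nth_rewrite 1 [h1]
  rw [h2, ← Finset.sum_add_distrib]
  refine Finset.sum_congr rfl fun v _ => ?_
  rw [← Finset.sum_add_distrib, degree]
  refine Finset.sum_congr rfl fun w _ => ?_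
  rcases lt_trichotomy v w with h | h | h
  · simp [h, h.not_gt]
  · simp [h, G.mult_self]
  · simp [h, h.not_gt]

theorem exists_lowerDegree_le_laplacian_mulVec {V : Type*} [Fintype V] [LinearOrder V]
    [Nonempty V] (G : LoopFreeMultigraph V) (c : V → ℤ) :
    ∃ v, (G.lowerDegree v : ℝ) ≤ (G.laplacian *ᵥ (fun v => (c v : ℝ))) v := by
  obtain ⟨m, hm⟩ := Finite.exists_max c
  let T : Finset V := Finset.univ.filter fun v => c v = c m
  have hT : T.Nonempty := ⟨m, by simp [T]⟩
  -- Among the maximisers of c take the smallest vertex: every w < v then has c w < c v strictly.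
  let v := T.min' hT
  have hv : c v = c m := by simpa [T] using T.min'_mem hT
  refine ⟨v, ?_⟩
  have := cutDegree_le_laplacian_mulVec (G := G) (c := c)
    (S := (Finset.univ.filter (· < v))ᶜ) (v := v) (fun w => hv ▸ hm w) fun w hw => ?_
  · simpa [cutDegree, lowerDegree] using this
  · have hw' : w < v := by simpa using hw
    refine lt_of_le_of_ne (hv ▸ hm w) fun h => ?_
    exact absurd (T.min'_le w (by simp [T, h, hv])) (not_le.2 hw')

/-- Energy ignores constant shifts, so c may be normalised to vanish at one vertex. An energy bound
limits differences along edges, hence by connectedness all values, leaving finitely many integer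
candidates. -/
theorem Connected.exists_forall_energy_le (hG : G.Connected) (x : V → ℝ) :
    ∃ c : V → ℤ, ∀ c' : V → ℤ,
      G.energy (fun v => (c v : ℝ) - x v) ≤ G.energy (fun v => (c' v : ℝ) - x v) := by
  obtain ⟨v₀⟩ := hG.nonempty
  let E : (V → ℤ) → ℝ := fun c => G.energy (fun v => (c v : ℝ) - x v)
  let A : Set (V → ℤ) := {c | c v₀ = 0 ∧ E c ≤ E 0}
  have hbound : ∀ v, ∃ B : ℝ, ∀ c ∈ A, |(c v : ℝ)| ≤ B := by
    refine hG.induction (v₀ := v₀) ⟨0, fun c hc => by simp [hc.1]⟩ ?_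
    rintro v w hvw ⟨B, hB⟩
    refine ⟨B + |x v - x w| + (E 0 + 1), fun c hc => ?_⟩
    have h1 := (G.mult_mul_sq_le_energy (fun v => (c v : ℝ) - x v) v w).trans hc.2
    have hvw' : (1 : ℝ) ≤ G.mult v w := by exact_mod_cast hvw
    set y : ℝ := ((c v : ℝ) - x v) - (c w - x w) with hy
    have h2 : y ^ 2 ≤ E 0 := (le_mul_of_one_le_left (sq_nonneg y) hvw').trans h1
    have h3 : |y| ≤ E 0 + 1 := by
      rw [← sq_abs] at h2
      nlinarith [sq_nonneg (|y| - 1), abs_nonneg y]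
    have h4 : (c w : ℝ) = c v + -(x v - x w) + -y := by rw [hy]; ring
    rw [h4]
    refine (abs_add_three _ _ _).trans ?_
    rw [abs_neg, abs_neg]
    gcongr
    exact hB c hc
  choose B hB using hbound
  have hfin : A.Finite := by
    refine (Set.finite_Icc (fun v => -⌈B v⌉) (fun v => ⌈B v⌉)).subset fun c hc => ?_
    have h : ∀ v, -⌈B v⌉ ≤ c v ∧ c v ≤ ⌈B v⌉ := fun v => by
      have h1 := abs_le.1 ((hB v c hc).trans (Int.le_ceil _))
      exact ⟨by exact_mod_cast h1.1, by exact_mod_cast h1.2⟩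
    exact ⟨fun v => (h v).1, fun v => (h v).2⟩
  obtain ⟨c, hcA, hc⟩ := Set.exists_min_image A E hfin ⟨0, by simp [A]⟩
  refine ⟨c, fun c' => ?_⟩
  have hshift : E (fun v => c' v - c' v₀) = E c' := by
    refine Finset.sum_congr rfl fun v _ => Finset.sum_congr rfl fun w _ => ?_
    push_cast; ring
  change E c ≤ E c'
  rcases le_total (E c') (E 0) with h | h
  · rw [← hshift]
    exact hc _ ⟨by simp, hshift.trans_le h⟩
  · exact hcA.2.trans h

theorem energy_sub_single (y : V → ℝ) (v : V) :
    G.energy (y - Pi.single v 1) =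
      G.energy y - 4 * (G.laplacian *ᵥ y) v + 2 * G.degree v := by
  have h : y ⬝ᵥ (G.laplacian *ᵥ Pi.single v 1) = (G.laplacian *ᵥ y) v := by
    rw [Matrix.dotProduct_mulVec, ← Matrix.mulVec_transpose, laplacian_transpose]
    simp
  rw [← two_mul_dotProduct_laplacian, ← two_mul_dotProduct_laplacian, Matrix.mulVec_sub,
    sub_dotProduct, dotProduct_sub, dotProduct_sub, h, single_one_dotProduct,
    single_one_dotProduct, Matrix.mulVec_single_one]
  simp only [Matrix.col_apply, laplacian_apply_self]
  ring

/-- Every real divisor whose degree is the number of edges dominates an element of the Laplacian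
lattice. -/
theorem Connected.exists_laplacian_mulVec_le (hG : G.Connected) {D : V → ℝ}
    (hD : 2 * ∑ v, D v = ∑ v, (G.degree v : ℝ)) :
    ∃ c : V → ℤ, ∀ v, (G.laplacian *ᵥ (fun v => (c v : ℝ))) v ≤ D v := by
  -- Minimality against c - e_v will give Q(c - x)(v) ≤ deg(v)/2; choosing Qx = D - deg/2 turns this
  -- into Qc ≤ D.
  obtain ⟨x, hx⟩ := hG.exists_laplacian_mulVec_eq (p := fun v => D v - G.degree v / 2) (by
    rw [Finset.sum_sub_distrib, ← Finset.sum_div]; linarith)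
  obtain ⟨c, hc⟩ := hG.exists_forall_energy_le x
  refine ⟨c, fun v => ?_⟩
  have h1 := hc (c - Pi.single v 1)
  have h2 : (fun w => (((c - Pi.single v 1 : V → ℤ) w : ℤ) : ℝ) - x w) =
      (fun w => (c w : ℝ) - x w) - Pi.single v 1 := by
    ext w
    by_cases hw : w = v
    · subst hw; simp; ring
    · simp [hw]
  rw [h2, energy_sub_single] at h1
  have h3 : G.laplacian *ᵥ (fun w => (c w : ℝ) - x w) =
      G.laplacian *ᵥ (fun w => (c w : ℝ)) - G.laplacian *ᵥ x := Matrix.mulVec_sub _ _ _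
  rw [h3, hx, Pi.sub_apply] at h1
  linarith

end Covering

end LoopFreeMultigraph

/-! ### Simplex inequalities and the two radii. -/

namespace SimplicialLattice

theorem mem_simplex {n : ℕ} {x : Fin (n + 1) → ℝ} :
    x ∈ simplex n ↔ ∑ i, x i = 0 ∧ ∀ i, -1 ≤ x i := by
  constructor
  · intro hx
    have hconv : Convex ℝ {x : Fin (n + 1) → ℝ | ∑ i, x i = 0 ∧ ∀ i, -1 ≤ x i} := by
      rintro x ⟨hx, hx'⟩ y ⟨hy, hy'⟩ a b ha hb hab
      refine ⟨by simp [Finset.sum_add_distrib, ← Finset.mul_sum, hx, hy], fun i => ?_⟩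
      have := mul_le_mul_of_nonneg_left (hx' i) ha
      have := mul_le_mul_of_nonneg_left (hy' i) hb
      simp only [Pi.add_apply, Pi.smul_apply, smul_eq_mul]
      linarith
    refine convexHull_min ?_ hconv hx
    rintro _ ⟨i, rfl⟩
    refine ⟨?_, fun j => ?_⟩
    · have : ∀ j, simplexVertex n i j = (if i = j then (n + 1 : ℝ) else 0) - 1 := fun j => by
        unfold simplexVertex; split_ifs <;> ring
      simp [this]
    · unfold simplexVertex
      split_ifs
      · have : (0 : ℝ) ≤ n := Nat.cast_nonneg n
        linarith
      · exact le_rfl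
  · rintro ⟨hx, hx'⟩
    have hn : (0 : ℝ) < n + 1 := by positivity
    -- The barycentric coordinates of x are (x i + 1)/(n + 1).
    have hsum : ∑ i, (x i + 1) / ((n : ℝ) + 1) = 1 := by
      rw [← Finset.sum_div, Finset.sum_add_distrib, hx]
      simp [hn.ne']
    have : x = ∑ i, ((x i + 1) / ((n : ℝ) + 1)) • simplexVertex n i := by
      ext j
      have h : ∀ i, simplexVertex n i j = (if i = j then (n + 1 : ℝ) else 0) - 1 := fun i => by
        unfold simplexVertex; split_ifs <;> ring
      simp only [Finset.sum_apply, Pi.smul_apply, smul_eq_mul, h, mul_sub, mul_one,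
        Finset.sum_sub_distrib, hsum, mul_ite, mul_zero, Finset.sum_ite_eq', Finset.mem_univ,
        if_true]
      field_simp
      ring
    rw [this]
    exact (convex_convexHull ℝ _).sum_mem
      (fun i _ => div_nonneg (by linarith [hx' i]) hn.le) hsum
      (fun i _ => subset_convexHull ℝ _ ⟨i, rfl⟩)

theorem mem_dilate_simplex {n : ℕ} {p x : Fin (n + 1) → ℝ} {R : ℝ} (hR : 0 ≤ R) :
    x ∈ dilate (simplex n) p R ↔ ∑ i, x i = ∑ i, p i ∧ ∀ i, p i - R ≤ x i := by
  constructor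
  · rintro ⟨y, hy, rfl⟩
    obtain ⟨hy0, hy1⟩ := mem_simplex.1 hy
    refine ⟨by simp [Finset.sum_add_distrib, ← Finset.mul_sum, hy0], fun i => ?_⟩
    have := mul_le_mul_of_nonneg_left (hy1 i) hR
    simp only [Pi.add_apply, Pi.smul_apply, smul_eq_mul]
    linarith
  · rintro ⟨hx, hx'⟩
    rcases hR.eq_or_lt with rfl | hR
    · refine ⟨0, mem_simplex.2 (by simp), ?_⟩
      ext i
      -- For R = 0 rescaling is impossible, but p ≤ x with equal sums forces x = p.
      have := (Finset.sum_eq_sum_iff_of_le (s := Finset.univ) (f := p) (g := x)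
        (fun i _ => by linarith [hx' i])).1 hx.symm i (Finset.mem_univ i)
      simpa using this
    · refine ⟨R⁻¹ • (x - p), mem_simplex.2 ⟨?_, fun i => ?_⟩, ?_⟩
      · simp [← Finset.mul_sum, hx]
      · have := mul_le_mul_of_nonneg_left (hx' i) (inv_nonneg.2 hR.le)
        have h1 := inv_mul_cancel₀ hR.ne'
        simp only [Pi.sub_apply, Pi.smul_apply, smul_eq_mul]
        linarith
      · simp [smul_smul, hR.ne']

theorem dilate_simplex_inter_eq_empty_iff {n : ℕ} {p q : Fin (n + 1) → ℝ} {R : ℝ} (hR : 0 ≤ R)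
    (hpq : ∑ i, p i = ∑ i, q i) :
    dilate (simplex n) p R ∩ dilate (simplex n) q R = ∅ ↔
      ((n : ℝ) + 1) * R < ∑ i, max ((p - q) i) 0 := by
  have hn : (0 : ℝ) < n + 1 := by positivity
  rw [← not_iff_not, ← Ne, ← Set.nonempty_iff_ne_empty, not_lt]
  constructor
  · rintro ⟨x, hxp, hxq⟩
    obtain ⟨hp, hp'⟩ := (mem_dilate_simplex hR).1 hxp
    obtain ⟨hq, hq'⟩ := (mem_dilate_simplex hR).1 hxq
    have : ∑ i, max ((p - q) i) 0 ≤ ∑ i, (x i - q i + R) := by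
      refine Finset.sum_le_sum fun i _ => max_le ?_ ?_
      · have := hp' i
        simp only [Pi.sub_apply]; linarith
      · have := hq' i
        linarith
    simpa [Finset.sum_add_distrib, hq] using this
  · intro h
    set T := ∑ i, max ((p - q) i) 0
    have hT : T / (n + 1) ≤ R := (div_le_iff₀ hn).2 (by linarith)
    have hsum : ∑ i, (q i + max ((p - q) i) 0 - T / (n + 1)) = ∑ i, q i := by
      rw [Finset.sum_sub_distrib, Finset.sum_add_distrib]
      simp only [Finset.sum_const, Finset.card_univ, Fintype.card_fin, nsmul_eq_mul]
      push_cast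
      field_simp
      simp [T]
    -- The witness is max(p, q) lowered uniformly to the right coordinate sum; the amount lowered is
    -- at most R.
    refine ⟨fun i => q i + max ((p - q) i) 0 - T / (n + 1), (mem_dilate_simplex hR).2
      ⟨by rw [hsum, hpq], fun i => ?_⟩, (mem_dilate_simplex hR).2 ⟨hsum, fun i => ?_⟩⟩
    · have := le_max_left ((p - q) i) 0
      simp only [Pi.sub_apply] at this ⊢
      linarith
    · have := le_max_right ((p - q) i) 0
      linarith

theorem packingRadius_laplacianLattice {n : ℕ} (hn : 1 ≤ n) {G : LoopFreeMultigraph (Fin (n + 1))}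
    (hG : G.Connected) :
    packingRadius (simplex n) G.laplacianLattice = G.minCut / ((n : ℝ) + 1) := by
  have : Nontrivial (Fin (n + 1)) := Fin.nontrivial_iff_two_le.2 (by omega)
  have hn' : (0 : ℝ) < n + 1 := by positivity
  have hsum : ∀ p ∈ G.laplacianLattice, ∑ i, p i = 0 := fun p hp => by
    obtain ⟨c, rfl⟩ := G.mem_laplacianLattice.1 hp
    exact G.sum_laplacian_mulVec _
  -- The simplices are closed, so they touch at the critical radius and the interval is half-open.
  have hset : {R : ℝ | 0 ≤ R ∧ ∀ p ∈ G.laplacianLattice, ∀ q ∈ G.laplacianLattice, p ≠ q →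
      dilate (simplex n) p R ∩ dilate (simplex n) q R = ∅} =
      Set.Ico 0 (G.minCut / ((n : ℝ) + 1)) := by
    ext R
    refine and_congr_right fun hR => ?_
    rw [lt_div_iff₀ hn', mul_comm]
    constructor
    · intro h
      obtain ⟨S, -, -, hS⟩ := G.exists_cutWeight_eq_minCut
      have hq := G.laplacian_mulVec_intCast_mem (fun v => if v ∈ S then 1 else 0)
      have hval := LoopFreeMultigraph.sum_posPart_laplacian_mulVec_indicator (G := G) S
      set q := G.laplacian *ᵥ (fun v => (((if v ∈ S then 1 else 0 : ℤ)) : ℝ))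
      have hq0 : q ≠ 0 := fun h0 => by
        have hpos := hG.minCut_pos
        rw [h0] at hval
        simp only [Pi.zero_apply, max_self, Finset.sum_const_zero] at hval
        have : G.cutWeight S = 0 := by exact_mod_cast hval.symm
        omega
      have := (dilate_simplex_inter_eq_empty_iff hR (by simp [hsum q hq])).1
        (h q hq 0 (zero_mem _) hq0)
      rwa [sub_zero, hval, ← hS] at this
    · intro h p hp q hq hpq
      rw [dilate_simplex_inter_eq_empty_iff hR (by rw [hsum p hp, hsum q hq])]
      obtain ⟨c, hc⟩ := G.mem_laplacianLattice.1 (sub_mem hp hq)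
      rw [hc]
      refine h.trans_le (LoopFreeMultigraph.minCut_le_sum_posPart ?_)
      rw [← hc]
      exact sub_ne_zero.2 hpq
  rw [packingRadius, hset, csSup_Ico]
  have : (0 : ℝ) < G.minCut := by exact_mod_cast hG.minCut_pos
  positivity

theorem coveringRadius_laplacianLattice {n : ℕ} {G : LoopFreeMultigraph (Fin (n + 1))}
    (hG : G.Connected) :
    coveringRadius (simplex n) G.laplacianLattice =
      (∑ v, (G.degree v : ℝ)) / (2 * ((n : ℝ) + 1)) := by
  have hn' : (0 : ℝ) < n + 1 := by positivity
  set d := ∑ v, (G.degree v : ℝ) with hd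
  have hd0 : 0 ≤ d := Finset.sum_nonneg fun _ _ => Nat.cast_nonneg _
  set r := d / (2 * ((n : ℝ) + 1)) with hr
  have hr0 : 0 ≤ r := by positivity
  have hrd : 2 * ((n + 1 : ℝ) * r) = d := by rw [hr]; field_simp
  have hset : {R : ℝ | 0 ≤ R ∧ ∀ p ∈ Submodule.span ℝ (G.laplacianLattice : Set (Fin (n + 1) → ℝ)),
      ∃ q ∈ G.laplacianLattice, p ∈ dilate (simplex n) q R} = Set.Ici r := by
    ext R
    constructor
    · rintro ⟨hR, h⟩
      by_contra hlt
      rw [Set.mem_Ici, not_le] at hlt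
      have hlow : 2 * ∑ v, (G.lowerDegree v : ℝ) = d := by
        rw [hd]; exact_mod_cast G.two_mul_sum_lowerDegree
      -- A deep hole: if q covered it with R < r, then q would lie strictly below the indegree
      -- vector in every coordinate.
      obtain ⟨q, hq, hpq⟩ := h (fun v => (G.lowerDegree v : ℝ) - r)
        (hG.mem_span_laplacianLattice.2 (by
          simp only [Finset.sum_sub_distrib, Finset.sum_const, Finset.card_univ,
            Fintype.card_fin, nsmul_eq_mul]
          push_cast
          linarith))
      obtain ⟨c, rfl⟩ := G.mem_laplacianLattice.1 hq
      obtain ⟨v, hv⟩ := G.exists_lowerDegree_le_laplacian_mulVec c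
      have := ((mem_dilate_simplex hR).1 hpq).2 v
      linarith
    · intro hR
      have hR0 : 0 ≤ R := hr0.trans hR
      refine ⟨hR0, fun p hp => ?_⟩
      have hp0 := hG.mem_span_laplacianLattice.1 hp
      obtain ⟨c, hc⟩ := hG.exists_laplacian_mulVec_le (D := fun v => p v + r) (by
        simp only [Finset.sum_add_distrib, hp0, Finset.sum_const, Finset.card_univ,
          Fintype.card_fin, nsmul_eq_mul]
        push_cast
        linarith)
      refine ⟨_, G.laplacian_mulVec_intCast_mem c, (mem_dilate_simplex hR0).2
        ⟨by rw [hp0, G.sum_laplacian_mulVec], fun v => ?_⟩⟩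
      have := hc v
      have : r ≤ R := hR
      linarith
  rw [coveringRadius, hset, csInf_Ici]

end SimplicialLattice

/-! ### Characteristic polynomial, lattice index and sorting. -/

section Charpoly

open Polynomial

/-- The characteristic polynomial of a matrix with vanishing row and column sums: it is divisible
by `X`, and a cofactor gives its linear coefficient. -/
theorem Matrix.exists_charpoly_eq_X_mul {R : Type*} [CommRing R] {n : ℕ}
    {A : Matrix (Fin (n + 1)) (Fin (n + 1)) R} (hrow : ∀ i, ∑ j, A i j = 0)
    (hcol : ∀ j, ∑ i, A i j = 0) :
    ∃ g : R[X], A.charpoly = X * g ∧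
      g.eval 0 = (-1) ^ n * ((n + 1 : R) * (A.submatrix Fin.succ Fin.succ).det) := by
  refine ⟨(A.charmatrix.updateRow 0 1).det, ?_, ?_⟩
  · have h1 := Matrix.det_updateRow_sum A.charmatrix 0 (fun _ => 1)
    have h2 : ∑ k, (1 : R[X]) • A.charmatrix k = (X : R[X]) • (1 : Fin (n + 1) → R[X]) := by
      ext1 j
      rw [Finset.sum_apply]
      change ∑ k, (1 : R[X]) * A.charmatrix k j = X * 1
      simp [Matrix.charmatrix_apply, Matrix.diagonal_apply, Finset.sum_sub_distrib, ← map_sum, hcol]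
    rw [h2, Matrix.det_updateRow_smul, one_smul] at h1
    exact h1.symm
  · set B : Matrix (Fin (n + 1)) (Fin (n + 1)) R := (-A).updateRow 0 1 with hB
    have h0 : (A.charmatrix.updateRow 0 1).det.eval 0 = B.det := by
      rw [← Polynomial.coe_evalRingHom, RingHom.map_det]
      congr 1
      ext i j
      refine Fin.cases ?_ (fun i => ?_) i
      · simp [hB]
      · simp [hB, Matrix.charmatrix_apply, Matrix.diagonal_apply, apply_ite]
    -- Adding all columns to column 0 leaves only n + 1 on top, by the row sums; expansion gives the
    -- cofactor, and negation the sign.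
    have h1 := Matrix.det_updateCol_sum B 0 (fun _ => 1)
    have h2 : (fun k => ∑ i, (1 : R) • B k i) = Pi.single 0 ((n : R) + 1) := by
      ext k
      refine Fin.cases ?_ (fun k => ?_) k
      · simp [hB]
      · simp [hB, hrow]
    rw [h2, one_smul, Matrix.det_succ_column_zero, Fin.sum_univ_succ] at h1
    rw [h0, ← h1]
    have h3 : (B.updateCol 0 (Pi.single 0 ((n : R) + 1))).submatrix Fin.succ Fin.succ =
        -(A.submatrix Fin.succ Fin.succ) := by
      ext i j
      simp [hB]
    simp only [Matrix.updateCol_self, Fin.val_zero, pow_zero, one_mul, Pi.single_eq_same,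
      Fin.succAbove_zero, h3, Matrix.det_neg, Fintype.card_fin]
    simp
    ring

end Charpoly

/-- The index of the image of a nonsingular integer matrix. -/
theorem Matrix.index_range_mulVecLin {ι : Type*} [Fintype ι] [DecidableEq ι]
    {M : Matrix ι ι ℤ} (hM : M.det ≠ 0) :
    (LinearMap.range M.mulVecLin).toAddSubgroup.index = M.det.natAbs := by
  have hinj : Function.Injective M.mulVecLin := Matrix.mulVec_injective_of_det_ne_zero hM
  have h := Submodule.natAbs_det_equiv (LinearMap.range M.mulVecLin)
    (LinearEquiv.ofInjective M.mulVecLin hinj)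
  have h2 : (LinearMap.range M.mulVecLin).subtype ∘ₗ AddMonoidHom.toIntLinearMap
      ((LinearEquiv.ofInjective M.mulVecLin hinj : (ι → ℤ) ≃ₗ[ℤ] _) : (ι → ℤ) →+ _) =
      M.mulVecLin := by
    ext; rfl
  rw [h2, ← Matrix.toLin'_apply', LinearMap.det_toLin'] at h
  exact h.symm

theorem Multiset.exists_monotone_map_univ_eq {n : ℕ} {α : Type*} [LinearOrder α]
    (s : Multiset α) (hs : s.card = n) :
    ∃ f : Fin n → α, Monotone f ∧ Multiset.map f Finset.univ.val = s := by
  subst hs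
  have hlen : (s.sort (· ≤ ·)).length = s.card := Multiset.length_sort ..
  refine ⟨fun i => (s.sort (· ≤ ·)).get (i.cast hlen.symm), fun i j hij => ?_, ?_⟩
  · exact (Multiset.pairwise_sort s (· ≤ ·)).rel_get_of_le (by simpa using hij)
  · conv_rhs => rw [← Multiset.sort_eq s (· ≤ ·)]
    rw [Fin.univ_val_map]
    congr 1
    apply List.ext_get
    · simp
    · intro i h1 h2
      simp

/-! ### Reduced Laplacian and nonzero spectrum. -/

namespace LoopFreeMultigraph

variable {n : ℕ}

/-- The integer Laplacian with the row and the column of the vertex `0` removed. -/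
def reducedLaplacian (G : LoopFreeMultigraph (Fin (n + 1))) : Matrix (Fin n) (Fin n) ℤ :=
  Matrix.of fun i j => (if i = j then (G.degree i.succ : ℤ) else 0) - G.mult i.succ j.succ

variable (G : LoopFreeMultigraph (Fin (n + 1)))

theorem reducedLaplacian_map :
    G.reducedLaplacian.map (Int.cast : ℤ → ℝ) = G.laplacian.submatrix Fin.succ Fin.succ := by
  ext i j
  simp [reducedLaplacian, laplacian, Matrix.diagonal_apply]

theorem intCast_det_reducedLaplacian :
    (G.reducedLaplacian.det : ℝ) = (G.laplacian.submatrix Fin.succ Fin.succ).det := by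
  rw [← reducedLaplacian_map]
  exact RingHom.map_det (Int.castRingHom ℝ) _

theorem reducedLaplacian_mulVec (z : Fin n → ℤ) (i : Fin n) :
    (((G.reducedLaplacian *ᵥ z) i : ℤ) : ℝ) =
      (G.laplacian *ᵥ (fun v => ((Fin.cons 0 z : Fin (n + 1) → ℤ) v : ℝ))) i.succ := by
  have h := fun j => congrFun (congrFun G.reducedLaplacian_map i) j
  simp only [Matrix.map_apply, Matrix.submatrix_apply] at h
  simp [Matrix.mulVec, dotProduct, Fin.sum_univ_succ, h]

variable {G}

/-- A kernel vector extended by 0 at vertex 0 is killed by Q off vertex 0, hence also there since Qc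
sums to zero; so it is constant, equal to 0. -/
theorem Connected.det_reducedLaplacian_ne_zero (hG : G.Connected) :
    G.reducedLaplacian.det ≠ 0 := by
  intro h
  obtain ⟨z, hz, hz0⟩ := Matrix.exists_mulVec_eq_zero_iff.2 h
  refine hz ?_
  set c : Fin (n + 1) → ℝ := fun v => ((Fin.cons 0 z : Fin (n + 1) → ℤ) v : ℝ) with hc
  have hsucc : ∀ i : Fin n, (G.laplacian *ᵥ c) i.succ = 0 := fun i => by
    rw [← reducedLaplacian_mulVec, hz0]; simp
  have h0 := G.sum_laplacian_mulVec c
  rw [Fin.sum_univ_succ] at h0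
  simp only [hsucc, Finset.sum_const_zero, add_zero] at h0
  have hzero : G.laplacian *ᵥ c = 0 := by
    ext v
    exact Fin.cases h0 hsucc v
  ext i
  have := hG.eq_of_laplacian_mulVec_eq_zero hzero i.succ 0
  simpa [hc] using this

theorem Connected.det_reducedLaplacian_pos (hG : G.Connected) : 0 < G.reducedLaplacian.det := by
  refine lt_of_le_of_ne ?_ hG.det_reducedLaplacian_ne_zero.symm
  have := (G.laplacian_posSemidef.submatrix Fin.succ).det_nonneg
  rw [← intCast_det_reducedLaplacian] at this
  exact_mod_cast this

/-- With charpoly = X · g and g(0) ≠ 0, the nonzero eigenvalues are the roots of g, which splits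
because Q is symmetric. The trace gives their sum and g(0) their product. -/
theorem Connected.nonzeroEigenvalues_spec (hG : G.Connected) :
    G.nonzeroEigenvalues.card = n ∧
      G.nonzeroEigenvalues.sum = ∑ v, (G.degree v : ℝ) ∧
      G.nonzeroEigenvalues.prod = ((n : ℝ) + 1) * G.reducedLaplacian.det := by
  have hrow : ∀ i, ∑ j, G.laplacian i j = 0 := fun i => by
    have := congrFun G.laplacian_mulVec_one i
    simpa [Matrix.mulVec, dotProduct] using this
  obtain ⟨g, hg, hg0⟩ := Matrix.exists_charpoly_eq_X_mul hrow fun j => by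
    simpa only [G.laplacian_apply_comm] using hrow j
  rw [← intCast_det_reducedLaplacian] at hg0
  have hdet : (0 : ℝ) < G.reducedLaplacian.det := by exact_mod_cast hG.det_reducedLaplacian_pos
  have hgne : g.eval 0 ≠ 0 := by
    rw [hg0]
    exact mul_ne_zero (pow_ne_zero _ (by norm_num)) (by positivity)
  have hmonic : g.Monic := by
    have := G.laplacian.charpoly_monic
    rw [hg] at this
    exact Polynomial.monic_X.of_mul_monic_left this
  have hprod : Polynomial.X * g ≠ 0 := (Polynomial.monic_X.mul hmonic).ne_zero
  have hroots : G.laplacian.charpoly.roots = 0 ::ₘ g.roots := by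
    rw [hg, Polynomial.roots_mul hprod, Polynomial.roots_X, Multiset.singleton_add]
  have hev : G.nonzeroEigenvalues = g.roots := by
    rw [nonzeroEigenvalues, hroots, Multiset.filter_cons_of_neg _ (by simp),
      Multiset.filter_eq_self]
    rintro x hx rfl
    exact hgne (Polynomial.isRoot_of_mem_roots hx)
  have hsplits := G.laplacian_isHermitian.splits_charpoly
  have hgsplits : g.Splits := by
    rw [hg] at hsplits
    exact ((Polynomial.splits_mul Polynomial.X_ne_zero hmonic.ne_zero).1 hsplits).2
  have hdeg : g.natDegree = n := by
    have h := G.laplacian.charpoly_natDegree_eq_dim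
    rw [hg, Polynomial.natDegree_X_mul hmonic.ne_zero, Fintype.card_fin] at h
    omega
  have hcard : g.roots.card = n := by rw [← hgsplits.natDegree_eq_card_roots, hdeg]
  refine ⟨hev ▸ hcard, ?_, ?_⟩
  · have := Matrix.trace_eq_sum_roots_charpoly_of_splits hsplits
    rw [hroots, Multiset.sum_cons, zero_add, G.laplacian_trace] at this
    rw [hev, this]
  · have h := hgsplits.coeff_zero_eq_prod_roots_of_monic hmonic
    rw [Polynomial.coeff_zero_eq_eval_zero, hg0, hdeg] at h
    rw [hev]
    exact (mul_left_cancel₀ (pow_ne_zero n (by norm_num : (-1 : ℝ) ≠ 0)) h).symm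

end LoopFreeMultigraph

/-! ### Covolume as a determinant. -/

namespace SimplicialLattice

/-- The parametrization of the root lattice by its last `n` coordinates. -/
def rootLatticeParam (n : ℕ) : (Fin n → ℤ) →+ rootLattice n where
  toFun y := ⟨fun i => ((Fin.cons (-∑ j, y j) y : Fin (n + 1) → ℤ) i : ℝ),
    fun _ => ⟨_, rfl⟩, by simp [Fin.sum_univ_succ]⟩
  map_zero' := by
    ext i
    refine Fin.cases ?_ (fun i => ?_) i <;> simp
  map_add' x y := by
    ext i
    refine Fin.cases ?_ (fun i => ?_) i
    · simp [Finset.sum_add_distrib]; ring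
    · simp

theorem rootLatticeParam_surjective (n : ℕ) : Function.Surjective (rootLatticeParam n) := by
  rintro ⟨x, hx, hx0⟩
  choose k hk using id hx
  refine ⟨fun i => k i.succ, Subtype.ext (funext fun i => ?_)⟩
  refine Fin.cases ?_ (fun i => ?_) i
  · rw [Fin.sum_univ_succ] at hx0
    simp only [hk] at hx0
    simp only [rootLatticeParam, AddMonoidHom.coe_mk, ZeroHom.coe_mk, Fin.cons_zero, hk]
    push_cast
    linarith
  · simp [rootLatticeParam, hk]

/-- In the last n coordinates the Laplacian lattice becomes the image of the reduced Laplacian,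
whose index is its determinant. -/
theorem covolume_laplacianLattice {n : ℕ} {G : LoopFreeMultigraph (Fin (n + 1))}
    (hG : G.Connected) : (covolume G.laplacianLattice : ℝ) = G.reducedLaplacian.det := by
  have hcomap : (G.laplacianLattice.addSubgroupOf (rootLattice n)).comap (rootLatticeParam n) =
      (LinearMap.range G.reducedLaplacian.mulVecLin).toAddSubgroup := by
    ext y
    rw [AddSubgroup.mem_comap, AddSubgroup.mem_addSubgroupOf, G.mem_laplacianLattice,
      Submodule.mem_toAddSubgroup, LinearMap.mem_range]
    constructor
    · rintro ⟨c, hc⟩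
      -- Constants lie in the kernel of Q, so c may be shifted to vanish at vertex 0.
      refine ⟨fun i => c i.succ - c 0, funext fun i => ?_⟩
      have h1 := G.reducedLaplacian_mulVec (fun i => c i.succ - c 0) i
      have h2 := congrFun hc i.succ
      have h3 : (fun v => ((Fin.cons 0 (fun i : Fin n => c i.succ - c 0) :
          Fin (n + 1) → ℤ) v : ℝ)) = fun v => (c v : ℝ) - c 0 := by
        ext v
        refine Fin.cases ?_ (fun v => ?_) v <;> simp
      rw [h3] at h1
      simp only [G.laplacian_mulVec_apply, sub_sub_sub_cancel_right] at h1 h2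
      rw [← h2] at h1
      simp only [rootLatticeParam, AddMonoidHom.coe_mk, ZeroHom.coe_mk, Fin.cons_succ] at h1
      exact_mod_cast h1
    · rintro ⟨z, rfl⟩
      refine ⟨Fin.cons 0 z, ?_⟩
      set c : Fin (n + 1) → ℝ := fun v => ((Fin.cons 0 z : Fin (n + 1) → ℤ) v : ℝ)
      have hsucc : ∀ i : Fin n, (((G.reducedLaplacian *ᵥ z) i : ℤ) : ℝ) =
          (G.laplacian *ᵥ c) i.succ := G.reducedLaplacian_mulVec z
      have h0 := G.sum_laplacian_mulVec c
      rw [Fin.sum_univ_succ] at h0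
      ext i
      refine Fin.cases ?_ (fun i => ?_) i
      · simp only [rootLatticeParam, AddMonoidHom.coe_mk, ZeroHom.coe_mk, Fin.cons_zero,
          Matrix.mulVecLin_apply]
        push_cast
        simp only [hsucc]
        linarith
      · simpa [rootLatticeParam] using hsucc i
  have h : covolume G.laplacianLattice = G.reducedLaplacian.det.natAbs := by
    rw [covolume, ← AddSubgroup.index, ← AddSubgroup.index_comap_of_surjective _
      (rootLatticeParam_surjective n), hcomap,
      Matrix.index_range_mulVecLin hG.det_reducedLaplacian_ne_zero]
  rw [h, Nat.cast_natAbs, abs_of_pos hG.det_reducedLaplacian_pos]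

end SimplicialLattice

theorem mainTheorem5 (n : ℕ) (hn : 1 ≤ n) (G : LoopFreeMultigraph (Fin (n + 1)))
    (hG : G.Connected) :
    ∃ ev : Fin n → ℝ, Monotone ev ∧
      Multiset.map ev Finset.univ.val = G.nonzeroEigenvalues ∧
      SimplicialLattice.packingDensity (SimplicialLattice.simplex n) G.laplacianLattice =
        (G.minCut : ℝ) / (((n : ℝ) + 1) * (∏ i, ev i) ^ (1 / (n : ℝ))) ∧
      SimplicialLattice.coveringDensity (SimplicialLattice.simplex n) G.laplacianLattice =
        (∑ i, ev i) / (2 * ((n : ℝ) + 1) * (∏ i, ev i) ^ (1 / (n : ℝ))) := by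
  obtain ⟨hcard, hsum, hprod⟩ := hG.nonzeroEigenvalues_spec
  obtain ⟨ev, hmono, hev⟩ := Multiset.exists_monotone_map_univ_eq _ hcard
  have hs : ∑ i, ev i = ∑ v, (G.degree v : ℝ) := by rw [← hsum, ← hev]; rfl
  have hp : ∏ i, ev i = ((n : ℝ) + 1) * G.reducedLaplacian.det := by rw [← hprod, ← hev]; rfl
  refine ⟨ev, hmono, hev, ?_, ?_⟩
  · rw [SimplicialLattice.packingDensity, SimplicialLattice.packingRadius_laplacianLattice hn hG,
      SimplicialLattice.covolume_laplacianLattice hG, hp, div_div]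
  · rw [SimplicialLattice.coveringDensity, SimplicialLattice.coveringRadius_laplacianLattice hG,
      SimplicialLattice.covolume_laplacianLattice hG, hp, hs, div_div]
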